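/- Let $G$ be a finite simple graph (undirected, no loops, no multiple edges) that is unicyclic, that is, $G$ is connected and contains exactly one cycle (as a subgraph). Let $L_G = D_G - A_G$ be its Laplacian matrix, where $D_G$ is the diagonal matrix of vertex degrees and $A_G$ is the adjacency matrix. Then $$\operatorname{per}(L_G\circ L_G)\ \le\ \operatorname{per}(L_G)^2,$$ where $\circ$ denotes the Hadamard (entrywise) product of matrices and $\operatorname{per}(M)=\sum_{\sigma\in S_n}\prod_{i=1}^n M_{i,\sigma(i)}$ is the permanent of an $n\times n$ matrix $M$. -/

import Mathlib

open scoped Matrix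

/-- A subgraph of `G` is a cycle if it consists of exactly the vertices and edges of a closed walk
of `G` that is a cycle (so the base point and the orientation of the walk are forgotten). -/
def SimpleGraph.Subgraph.IsCycleSubgraph {V : Type*} {G : SimpleGraph V} (C : G.Subgraph) : Prop :=
  ∃ (v : V) (w : G.Walk v v), w.IsCycle ∧ w.toSubgraph = C

/-- A graph is unicyclic if it is connected and contains exactly one cycle. -/
def SimpleGraph.IsUnicyclic {V : Type*} (G : SimpleGraph V) : Prop :=
  G.Connected ∧ ∃! C : G.Subgraph, C.IsCycleSubgraph

open Equiv Equiv.Perm Finset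

/-! Expand both permanents over permutations, with `a σ` the product of Laplacian entries.
Involutions have `a σ ≥ 0`. Any other `σ` with `a σ ≠ 0` moves points along edges, so it rotates the
unique cycle `C` one way or the other and is an involution `μ` off `C`. Let `E` be the total weight
off `C` of such `μ`: the non-involutions weigh at most `2E` in absolute value
(`sum_abs_prod_le_two_mul_sum`). Conversely, vertices of `C` have degree at least 2, so the
involutions other than any given one weigh at least `6E` (`add_six_mul_sum_le_sum_involutions`).
This dominance gives the inequality by `sum_sq_le_sq_sum_of_dominant`. -/

theorem Equiv.Perm.IsCycle.three_le_card_support {V : Type*} [Fintype V] [DecidableEq V] {ρ : Perm V} (hρ : ρ.IsCycle) (h2 : ρ ^ 2 ≠ 1) :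
    3 ≤ #ρ.support := by
  have h := hρ.two_le_card_support
  rcases h.eq_or_lt with h | h
  · exact absurd (by rw [h, ← hρ.orderOf, pow_orderOf_eq_one]) h2
  · exact h

/-! ### Cyclic permutations along edges and cycles of the graph -/

namespace SimpleGraph

variable {V : Type*} {G : SimpleGraph V}

theorem exists_walk_getVert_eq (n : ℕ) (f : ℕ → V) (hf : ∀ i < n, G.Adj (f i) (f (i + 1)))
    {u v : V} (hu : f 0 = u) (hv : f n = v) :
    ∃ w : G.Walk u v, w.length = n ∧ ∀ i ≤ n, w.getVert i = f i := by
  induction n generalizing f u with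
  | zero =>
    subst hu hv
    exact ⟨.nil, rfl, fun i hi => by simp [Nat.le_zero.mp hi]⟩
  | succ n ih =>
    subst hu
    obtain ⟨w, hw, hw'⟩ := ih (fun i => f (i + 1)) (fun i hi => hf (i + 1) (by lia)) rfl hv
    refine ⟨.cons (hf 0 (by lia)) w, by simp [hw], fun i hi => ?_⟩
    cases i with
    | zero => simp
    | succ i => simpa using hw' i (by lia)

section Fintype

variable [Fintype V] [DecidableEq V]

/-- The orbit of a cyclic permutation that moves points along edges is a cycle of the graph. -/
theorem exists_isCycleSubgraph_adj_iff {ρ : Perm V} (hρ : ρ.IsCycle) (h2 : ρ ^ 2 ≠ 1)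
    (hadj : ∀ i, ρ i ≠ i → G.Adj i (ρ i)) :
    ∃ C : G.Subgraph, C.IsCycleSubgraph ∧
      ∀ u v, C.Adj u v ↔ ρ u ≠ u ∧ (v = ρ u ∨ u = ρ v) := by
  obtain ⟨x, hx, hx'⟩ := id hρ
  have hcard := hρ.three_le_card_support h2
  rw [← hρ.orderOf] at hcard
  have hmove (i : ℕ) : ρ ((ρ ^ i) x) ≠ (ρ ^ i) x := by
    rw [← Perm.mem_support, pow_apply_mem_support, Perm.mem_support]; exact hx
  obtain ⟨w, hlen, hw⟩ := exists_walk_getVert_eq (G := G) (u := x) (v := x) (orderOf ρ)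
    (fun i => (ρ ^ i) x) (fun i _ => by simpa only [pow_succ', mul_apply] using hadj _ (hmove i))
    (by simp) (by simp [pow_orderOf_eq_one])
  refine ⟨w.toSubgraph, ⟨x, w, ?_, rfl⟩, fun u v => ?_⟩
  -- The tail visits `ρ ^ (i + 1)` at `x`; cancelling one factor `ρ` brings the exponents below the
  -- order.
  · rw [Walk.isCycle_iff_isPath_tail_and_le_length, hlen, ← Walk.IsPath.getVert_injOn_iff]
    refine ⟨fun i hi j hj hij => ?_, hcard⟩
    have hnil : ¬ w.Nil := by rw [Walk.not_nil_iff_lt_length]; lia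
    have hl := Walk.length_tail_add_one hnil
    simp only [Set.mem_ofPred_eq] at hi hj
    rw [Walk.getVert_tail, Walk.getVert_tail, hw _ (by lia), hw _ (by lia)] at hij
    have := hρ.pow_eq_pow_iff.mpr ⟨x, hx, hij⟩
    rw [pow_succ', pow_succ'] at this
    exact pow_injOn_Iio_orderOf (by simp; lia) (by simp; lia) (mul_left_cancel this)
  · rw [Walk.toSubgraph_adj_iff, hlen]
    have hget (i : ℕ) (hi : i < orderOf ρ) :
        w.getVert i = (ρ ^ i) x ∧ w.getVert (i + 1) = ρ ((ρ ^ i) x) := by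
      rw [hw _ hi.le, hw _ (by lia), pow_succ', mul_apply]
      exact ⟨rfl, rfl⟩
    have hex (y : V) (hy : ρ y ≠ y) : ∃ i < orderOf ρ, (ρ ^ i) x = y := by
      obtain ⟨i, hi⟩ := hρ.exists_pow_eq hx hy
      exact ⟨i % orderOf ρ, Nat.mod_lt _ (by lia), by rw [pow_mod_orderOf, hi]⟩
    constructor
    · rintro ⟨i, hi, hlt⟩
      rw [(hget i hlt).1, (hget i hlt).2, Sym2.eq_iff] at hi
      have := hmove i
      rcases hi with ⟨rfl, rfl⟩ | ⟨rfl, rfl⟩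
      · exact ⟨this, .inl rfl⟩
      · exact ⟨fun h => this (ρ.injective h), .inr rfl⟩
    · rintro ⟨hu, rfl | rfl⟩
      · obtain ⟨i, hi, rfl⟩ := hex u hu
        exact ⟨i, by rw [(hget i hi).1, (hget i hi).2], hi⟩
      · obtain ⟨i, hi, rfl⟩ := hex v fun h => hu (by rw [h, h])
        exact ⟨i, by rw [(hget i hi).1, (hget i hi).2, Sym2.eq_swap], hi⟩

/-- Agreement propagates along the orbit: if `ρ'` turned back at the next point, `ρ' ^ 2` would fix
a moved point. -/
theorem eq_of_isCycle_of_apply_eq_or {ρ ρ' : Perm V} (hρ : ρ.IsCycle) (hρ' : ρ'.IsCycle)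
    (h2' : ρ' ^ 2 ≠ 1) (hsupp : ∀ u, ρ' u ≠ u ↔ ρ u ≠ u)
    (h : ∀ u, ρ' u ≠ u → ρ' u = ρ u ∨ u = ρ (ρ' u)) {x : V} (hx : ρ' x ≠ x)
    (hxx : ρ' x = ρ x) : ρ' = ρ := by
  have key (k : ℕ) : ρ' ((ρ ^ k) x) = ρ ((ρ ^ k) x) := by
    induction k with
    | zero => simpa using hxx
    | succ k ih =>
      rw [pow_succ', mul_apply]
      set y := (ρ ^ k) x
      have hy : ρ' y ≠ y := by
        rw [hsupp, ← Perm.mem_support, pow_apply_mem_support, Perm.mem_support, ← hsupp]; exact hx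
      have hy' : ρ' (ρ' y) ≠ ρ' y := fun h => hy (ρ'.injective h)
      rcases h (ρ' y) hy' with h | h
      · rwa [ih] at h
      · rw [ih] at h
        exact absurd ((hρ'.pow_eq_one_iff' hy).mpr (by
          rw [pow_two, mul_apply, ih]; exact (ρ.injective h).symm)) h2'
  ext u
  by_cases hu : ρ u = u
  · rw [hu]; by_contra h; exact (hsupp u).mp h hu
  · obtain ⟨k, rfl⟩ := hρ.exists_pow_eq ((hsupp x).mp hx) hu
    exact key k

/-- In a graph with at most one cycle, any two cyclic permutations of order at least three that
move points along edges agree up to orientation. -/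
theorem eq_or_eq_inv_of_isCycle {ρ ρ' : Perm V}
    (hG : ∀ C C' : G.Subgraph, C.IsCycleSubgraph → C'.IsCycleSubgraph → C = C')
    (hρ : ρ.IsCycle) (h2 : ρ ^ 2 ≠ 1) (hadj : ∀ i, ρ i ≠ i → G.Adj i (ρ i))
    (hρ' : ρ'.IsCycle) (h2' : ρ' ^ 2 ≠ 1) (hadj' : ∀ i, ρ' i ≠ i → G.Adj i (ρ' i)) :
    ρ' = ρ ∨ ρ' = ρ⁻¹ := by
  obtain ⟨C, hC, hCadj⟩ := exists_isCycleSubgraph_adj_iff hρ h2 hadj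
  obtain ⟨C', hC', hCadj'⟩ := exists_isCycleSubgraph_adj_iff hρ' h2' hadj'
  obtain rfl := hG C C' hC hC'
  have hsupp (u : V) : ρ' u ≠ u ↔ ρ u ≠ u :=
    ⟨fun h => ((hCadj _ _).mp ((hCadj' u _).mpr ⟨h, .inl rfl⟩)).1,
      fun h => ((hCadj' _ _).mp ((hCadj u _).mpr ⟨h, .inl rfl⟩)).1⟩
  have happ (u : V) (h : ρ' u ≠ u) : ρ' u = ρ u ∨ u = ρ (ρ' u) :=
    ((hCadj _ _).mp ((hCadj' u _).mpr ⟨h, .inl rfl⟩)).2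
  obtain ⟨x, hx, -⟩ := id hρ'
  rcases happ x hx with h | h
  · exact .inl (eq_of_isCycle_of_apply_eq_or hρ hρ' h2' hsupp happ hx h)
  · refine .inr (eq_of_isCycle_of_apply_eq_or hρ.inv hρ' h2' (fun u => ?_) (fun u hu => ?_) hx ?_)
    · rw [hsupp, ne_eq, ne_eq, inv_eq_iff_eq, eq_comm (a := u)]
    · rw [eq_inv_iff_eq, eq_inv_iff_eq, eq_comm, eq_comm (b := ρ' u), or_comm]
      exact happ u hu
    · rw [eq_inv_iff_eq]; exact h.symm

theorem cycleOf_isCycle_and_adj {τ : Perm V} (hadj : ∀ i, τ i ≠ i → G.Adj i (τ i)) {x : V}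
    (hx : (τ ^ 2) x ≠ x) : (τ.cycleOf x).IsCycle ∧ (τ.cycleOf x) ^ 2 ≠ 1 ∧
      ∀ i, τ.cycleOf x i ≠ i → G.Adj i (τ.cycleOf x i) := by
  have hx1 : τ x ≠ x := fun h => hx (by rw [pow_two, mul_apply, h, h])
  refine ⟨isCycle_cycleOf τ hx1, fun h => hx ?_, fun i hi => ?_⟩
  · rw [← cycleOf_pow_apply_self, h, one_apply]
  · rw [cycleOf_apply] at hi ⊢
    split_ifs at hi ⊢ with hs
    · exact hadj i hi
    · exact absurd rfl hi

/-- A permutation of order at least three that moves points along edges is, in a graph with at most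
one cycle, the product of a rotation of that cycle and a disjoint involution. -/
theorem exists_disjoint_involution_of_sq_ne_one {ρ τ : Perm V}
    (hG : ∀ C C' : G.Subgraph, C.IsCycleSubgraph → C'.IsCycleSubgraph → C = C')
    (hρ : ρ.IsCycle) (h2 : ρ ^ 2 ≠ 1) (hadj : ∀ i, ρ i ≠ i → G.Adj i (ρ i))
    (hτ : τ ^ 2 ≠ 1) (hτadj : ∀ i, τ i ≠ i → G.Adj i (τ i)) :
    ∃ μ : Perm V, μ ^ 2 = 1 ∧ (∀ i ∈ ρ.support, μ i = i) ∧ (τ = μ * ρ ∨ τ = μ * ρ⁻¹) := by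
  have key (x : V) (hx : (τ ^ 2) x ≠ x) : τ.cycleOf x = ρ ∨ τ.cycleOf x = ρ⁻¹ := by
    obtain ⟨h₁, h₂, h₃⟩ := cycleOf_isCycle_and_adj hτadj hx
    exact eq_or_eq_inv_of_isCycle hG hρ h2 hadj h₁ h₂ h₃
  obtain ⟨x, hx⟩ : ∃ x, (τ ^ 2) x ≠ x := by
    by_contra! h; exact hτ (Perm.ext h)
  have hx1 : τ x ≠ x := fun h => hx (by rw [pow_two, mul_apply, h, h])
  have hmem : τ.cycleOf x ∈ τ.cycleFactorsFinset := by
    rw [cycleOf_mem_cycleFactorsFinset_iff, Perm.mem_support]; exact hx1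
  have hdis := disjoint_mul_inv_of_mem_cycleFactorsFinset hmem
  -- All cycles of `τ` of length at least three live on `ρ.support`, so `τ ^ 2` is trivial
  -- elsewhere.
  have hsup (y : V) (hy : (τ ^ 2) y ≠ y) : y ∈ ρ.support := by
    have hy1 : τ y ≠ y := fun h => hy (by rw [pow_two, mul_apply, h, h])
    have : y ∈ (τ.cycleOf y).support := by rw [Perm.mem_support, cycleOf_apply_self]; exact hy1
    rcases key y hy with h | h <;> rw [h] at this
    · exact this
    · rwa [support_inv] at this
  have hsupp : (τ.cycleOf x).support = ρ.support := by
    rcases key x hx with h | h <;> simp [h]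
  refine ⟨τ * (τ.cycleOf x)⁻¹, ?_, fun i hi => ?_, ?_⟩
  · ext y
    by_cases hy : τ.cycleOf x y = y
    · have hcomm := hdis.commute
      have hy2 : (τ ^ 2) y = y := by
        by_contra h
        have := hsup y h
        rw [← hsupp, Perm.mem_support] at this
        exact this hy
      have : τ ^ 2 = (τ * (τ.cycleOf x)⁻¹) ^ 2 * (τ.cycleOf x) ^ 2 := by
        rw [← hcomm.mul_pow, inv_mul_cancel_right]
      rw [this, mul_apply, pow_apply_eq_self_of_apply_eq_self hy] at hy2
      simpa using hy2
    · rw [one_apply, pow_apply_eq_self_of_apply_eq_self ((hdis y).resolve_right hy)]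
  · rw [← hsupp, Perm.mem_support] at hi
    exact (hdis i).resolve_right hi
  · rcases key x hx with h | h
    · left; rw [← h, inv_mul_cancel_right]
    · right; rw [← h, inv_mul_cancel_right]

end Fintype

end SimpleGraph

/-! ### The numerical inequality -/

/-- With `A` the sum over `I` and `B` the absolute sum off `I`, the left side is at most `A * (A - 3
* B) + B ^ 2 ≤ (A - B) ^ 2`, and `0 ≤ A - B` is at most the full sum. -/
theorem Finset.sum_sq_le_sq_sum_of_dominant {ι : Type*} [Fintype ι] [DecidableEq ι] (a : ι → ℝ)
    (I : Finset ι) (hne : I.Nonempty) (h0 : ∀ i ∈ I, 0 ≤ a i)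
    (h : ∀ i ∈ I, a i + 3 * ∑ j ∈ Iᶜ, |a j| ≤ ∑ j ∈ I, a j) :
    ∑ i, a i ^ 2 ≤ (∑ i, a i) ^ 2 := by
  rw [← sum_add_sum_compl I, ← sum_add_sum_compl I a]
  set A := ∑ j ∈ I, a j
  set B := ∑ j ∈ Iᶜ, |a j| with hB
  have hB0 : 0 ≤ B := sum_nonneg fun _ _ => abs_nonneg _
  have hB' : |∑ j ∈ Iᶜ, a j| ≤ B := abs_sum_le_sum_abs _ _
  obtain ⟨i, hi⟩ := hne
  have hAB : 3 * B ≤ A := by linarith [h i hi, h0 i hi]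
  have h1 : ∑ i ∈ I, a i ^ 2 ≤ A * (A - 3 * B) := by
    rw [sum_mul]
    refine sum_le_sum fun i hi => ?_
    rw [pow_two]
    exact mul_le_mul_of_nonneg_left (by linarith [h i hi]) (h0 i hi)
  have h2 : ∑ i ∈ Iᶜ, a i ^ 2 ≤ B * B := by
    rw [hB, sum_mul]
    refine sum_le_sum fun i hi => ?_
    rw [← sq_abs, pow_two]
    exact mul_le_mul_of_nonneg_left
      (single_le_sum (f := fun j => |a j|) (fun _ _ => abs_nonneg _) hi) (abs_nonneg _)
  have h3 := (abs_le.mp hB').1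
  nlinarith [mul_nonneg (by linarith : 0 ≤ A) (by linarith : 0 ≤ B + ∑ j ∈ Iᶜ, a j),
    mul_nonneg hB0 (by linarith : 0 ≤ A - B), sq_nonneg (∑ j ∈ Iᶜ, a j)]

/-! ### Weights of permutations in the Laplacian -/

namespace SimpleGraph

variable {V : Type*} [Fintype V] [DecidableEq V] (G : SimpleGraph V) [DecidableRel G.Adj]

theorem lapMatrix_apply_self (i : V) : G.lapMatrix ℝ i i = G.degree i := by
  simp [lapMatrix, degMatrix]

theorem lapMatrix_apply_of_ne {i j : V} (h : i ≠ j) :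
    G.lapMatrix ℝ i j = -if G.Adj i j then 1 else 0 := by
  simp [lapMatrix, degMatrix, h, adjMatrix_apply]

theorem abs_lapMatrix_apply_of_adj {i j : V} (h : G.Adj i j) : |G.lapMatrix ℝ i j| = 1 := by
  simp [lapMatrix_apply_of_ne G h.ne, h]

theorem adj_of_prod_lapMatrix_ne_zero {σ : Perm V} (h : ∏ i, G.lapMatrix ℝ (σ i) i ≠ 0) (i : V)
    (hi : σ i ≠ i) : G.Adj i (σ i) := by
  by_contra hadj
  refine h (prod_eq_zero (mem_univ i) ?_)
  rw [lapMatrix_apply_of_ne G hi, if_neg (fun h => hadj h.symm), neg_zero]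

/-- An involution moves an even number of points, so the signs cancel. -/
theorem prod_lapMatrix_eq_abs_of_sq_eq_one {σ : Perm V} (h : σ ^ 2 = 1) :
    ∏ i, G.lapMatrix ℝ (σ i) i = ∏ i, |G.lapMatrix ℝ (σ i) i| := by
  have hi (i : V) : G.lapMatrix ℝ (σ i) i =
      (if i ∈ σ.support then (-1) else 1) * |G.lapMatrix ℝ (σ i) i| := by
    by_cases hi : σ i = i
    · simp [hi, lapMatrix_apply_self]
    · rw [if_pos (Perm.mem_support.mpr hi), lapMatrix_apply_of_ne G hi]
      split_ifs <;> simp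
  obtain ⟨k, hk⟩ := two_dvd_card_support h
  rw [prod_congr rfl fun i _ => hi i, prod_mul_distrib, prod_ite, prod_const_one, mul_one,
    prod_const, filter_mem_eq_inter, univ_inter, hk, pow_mul]
  simp

/-- The product over `V` splits for a product of permutations of `s` and of its complement. -/
theorem prod_abs_lapMatrix_mul {s : Finset V} {μ π : Perm V} (hμ : ∀ i ∈ s, μ i = i)
    (hπ : ∀ i ∉ s, π i = i) :
    ∏ i, |G.lapMatrix ℝ ((μ * π) i) i| =
      (∏ i ∈ s, |G.lapMatrix ℝ (π i) i|) * ∏ i ∈ sᶜ, |G.lapMatrix ℝ (μ i) i| := by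
  rw [← prod_mul_prod_compl s]
  congr 1
  · refine prod_congr rfl fun i hi => ?_
    have : π i ∈ s := by
      by_contra h
      exact h (by rwa [π.injective (hπ _ h)])
    rw [mul_apply, hμ _ this]
  · refine prod_congr rfl fun i hi => ?_
    rw [mul_apply, hπ _ (mem_compl.mp hi)]

variable {G}

section Cycle

variable {ρ : Perm V} (hρ : ρ.IsCycle) (h2 : ρ ^ 2 ≠ 1) (hadj : ∀ i, ρ i ≠ i → G.Adj i (ρ i))

include hρ h2 in
theorem sq_apply_ne_of_mem_support {i : V} (hi : i ∈ ρ.support) : ρ (ρ i) ≠ i := fun h =>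
  h2 ((hρ.pow_eq_one_iff' (Perm.mem_support.mp hi)).mpr (by rwa [pow_two, mul_apply]))

include hρ h2 hadj in
theorem two_le_lapMatrix_apply_self {i : V} (hi : i ∈ ρ.support) :
    2 ≤ |G.lapMatrix ℝ i i| := by
  obtain ⟨j, rfl⟩ := ρ.surjective i
  rw [apply_mem_support] at hi
  have hj := Perm.mem_support.mp hi
  have hsub : {j, ρ (ρ j)} ⊆ G.neighborFinset (ρ j) := by
    intro k hk
    rw [mem_neighborFinset]
    rcases mem_insert.mp hk with rfl | hk
    · exact (hadj _ hj).symm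
    · rw [mem_singleton.mp hk]
      exact hadj _ fun h => hj (ρ.injective h)
  have := card_le_card hsub
  rw [card_pair (sq_apply_ne_of_mem_support hρ h2 hi).symm, card_neighborFinset_eq_degree] at this
  rw [lapMatrix_apply_self, Nat.abs_cast]
  exact_mod_cast this

include hρ h2 hadj in
theorem eight_le_prod_abs_lapMatrix_one :
    8 ≤ ∏ i ∈ ρ.support, |G.lapMatrix ℝ ((1 : Perm V) i) i| := by
  calc (8 : ℝ) = 2 ^ 3 := by norm_num
    _ ≤ 2 ^ #ρ.support := pow_le_pow_right₀ one_le_two (hρ.three_le_card_support h2)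
    _ = ∏ i ∈ ρ.support, (2 : ℝ) := (prod_const _).symm
    _ ≤ _ := prod_le_prod (fun _ _ => zero_le_two)
      fun i hi => two_le_lapMatrix_apply_self hρ h2 hadj hi

include hρ h2 hadj in
-- The swap fixes the third point `ρ (ρ x)`, which contributes its degree.
theorem two_le_prod_abs_lapMatrix_swap {x : V} (hx : x ∈ ρ.support) :
    2 ≤ ∏ i ∈ ρ.support, |G.lapMatrix ℝ (swap x (ρ x) i) i| := by
  have hx1 := Perm.mem_support.mp hx
  have hx2 := sq_apply_ne_of_mem_support hρ h2 hx
  have hmem : ρ (ρ x) ∈ ρ.support := by simpa using hx1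
  rw [← mul_prod_erase _ _ hmem]
  have h3 := two_le_lapMatrix_apply_self hρ h2 hadj hmem
  have h1 : 1 ≤ ∏ i ∈ ρ.support.erase (ρ (ρ x)), |G.lapMatrix ℝ (swap x (ρ x) i) i| := by
    rw [← prod_const_one (s := ρ.support.erase (ρ (ρ x)))]
    refine prod_le_prod (fun _ _ => zero_le_one) fun i hi => ?_
    by_cases hix : i = x
    · rw [hix, swap_apply_left, abs_lapMatrix_apply_of_adj G (hadj x hx1).symm]
    by_cases hiρ : i = ρ x
    · rw [hiρ, swap_apply_right, abs_lapMatrix_apply_of_adj G (hadj x hx1)]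
    rw [swap_apply_of_ne_of_ne hix hiρ]
    linarith [two_le_lapMatrix_apply_self hρ h2 hadj (mem_of_mem_erase hi)]
  rw [swap_apply_of_ne_of_ne hx2 fun h => hx1 (ρ.injective h)]
  nlinarith

include hadj in
theorem prod_abs_lapMatrix_cycle : ∏ i ∈ ρ.support, |G.lapMatrix ℝ (ρ i) i| = 1 :=
  prod_eq_one fun i hi => abs_lapMatrix_apply_of_adj G (hadj i (Perm.mem_support.mp hi)).symm

include hρ h2 hadj in
/-- Removing any one involution from the involution sum leaves at least six times the weight of the
involutions of the complement of the cycle. -/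
theorem add_six_mul_sum_le_sum_involutions {σ : Perm V} (hσ : σ ^ 2 = 1) :
    (∏ i, |G.lapMatrix ℝ (σ i) i|) +
      6 * ∑ μ : Perm V with μ ^ 2 = 1 ∧ ∀ i ∈ ρ.support, μ i = i,
        ∏ i ∈ ρ.supportᶜ, |G.lapMatrix ℝ (μ i) i| ≤
    ∑ τ : Perm V with τ ^ 2 = 1, ∏ i, |G.lapMatrix ℝ (τ i) i| := by
  set J : Finset (Perm V) := {μ : Perm V | μ ^ 2 = 1 ∧ ∀ i ∈ ρ.support, μ i = i} with hJ
  set I : Finset (Perm V) := {τ : Perm V | τ ^ 2 = 1} with hI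
  have hb0 (τ : Perm V) : 0 ≤ ∏ i, |G.lapMatrix ℝ (τ i) i| := prod_nonneg fun _ _ => abs_nonneg _
  have he0 (μ : Perm V) : 0 ≤ ∏ i ∈ ρ.supportᶜ, |G.lapMatrix ℝ (μ i) i| :=
    prod_nonneg fun _ _ => abs_nonneg _
  have hJ1 {μ : Perm V} (h : μ ∈ J) : μ ^ 2 = 1 := (mem_filter.mp h).2.1
  have hJ2 {μ : Perm V} (h : μ ∈ J) : ∀ i ∈ ρ.support, μ i = i := (mem_filter.mp h).2.2
  have hσI : σ ∈ I := by simpa [hI] using hσ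
  rw [← add_sum_erase I _ hσI, add_le_add_iff_left]
  -- If `σ ∈ J`, use instead each `μ` times a swap along an edge of the cycle: at least 3 swaps of
  -- weight at least 2. Otherwise `J` itself survives, with factor `2 ^ 3`.
  by_cases hσJ : σ ∈ J
  · have hswap {x : V} (hx : x ∈ ρ.support) : ∀ i ∉ ρ.support, swap x (ρ x) i = i := by
      intro i hi
      refine swap_apply_of_ne_of_ne (fun h => hi (h ▸ hx)) fun h => hi ?_
      rw [h, apply_mem_support]; exact hx
    have happ {μ : Perm V} (hμ : μ ∈ J) {x : V} (hx : x ∈ ρ.support) (i : V)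
        (hi : i ∈ ρ.support) : (μ * swap x (ρ x)) i = swap x (ρ x) i := by
      rw [mul_apply, hJ2 hμ]
      by_contra h
      exact h (by rwa [(swap x (ρ x)).injective (hswap hx _ h)])
    have hinj : Set.InjOn (fun p : Perm V × V => p.1 * swap p.2 (ρ p.2))
        (J ×ˢ ρ.support : Finset (Perm V × V)) := by
      rintro ⟨μ, x⟩ hp ⟨ν, y⟩ hq heq
      obtain ⟨hμ, hx⟩ := mem_product.mp (mem_coe.mp hp)
      obtain ⟨hν, hy⟩ := mem_product.mp (mem_coe.mp hq)
      simp only at heq hμ hx hν hy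
      have h1 : swap x (ρ x) = swap y (ρ y) := by
        ext i
        by_cases hi : i ∈ ρ.support
        · rw [← happ hμ hx i hi, ← happ hν hy i hi, heq]
        · rw [hswap hx i hi, hswap hy i hi]
      have h2' : μ = ν := by rw [h1] at heq; exact mul_right_cancel heq
      refine Prod.ext h2' ?_
      by_contra hxy
      have hxy : x ≠ y := hxy
      have h3 : ρ x = swap y (ρ y) x := by rw [← h1, swap_apply_left]
      -- Equal swaps with `x ≠ y` would traverse one edge both ways, forcing `ρ (ρ y) = y`.
      by_cases h4 : x = ρ y
      · rw [h4, swap_apply_right] at h3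
        exact sq_apply_ne_of_mem_support hρ h2 hy h3
      · rw [swap_apply_of_ne_of_ne hxy h4] at h3
        exact Perm.mem_support.mp hx h3
    calc 6 * ∑ μ ∈ J, ∏ i ∈ ρ.supportᶜ, |G.lapMatrix ℝ (μ i) i|
        ≤ ∑ μ ∈ J, ∑ x ∈ ρ.support, ∏ i, |G.lapMatrix ℝ ((μ * swap x (ρ x)) i) i| := by
          rw [mul_sum]
          refine sum_le_sum fun μ hμ => ?_
          have h3 : (3 : ℝ) ≤ #ρ.support := by exact_mod_cast hρ.three_le_card_support h2
          calc 6 * ∏ i ∈ ρ.supportᶜ, |G.lapMatrix ℝ (μ i) i|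
              ≤ #ρ.support * (2 * ∏ i ∈ ρ.supportᶜ, |G.lapMatrix ℝ (μ i) i|) := by
                nlinarith [he0 μ]
            _ = ∑ x ∈ ρ.support, 2 * ∏ i ∈ ρ.supportᶜ, |G.lapMatrix ℝ (μ i) i| := by
                rw [sum_const, nsmul_eq_mul]
            _ ≤ _ := by
                refine sum_le_sum fun x hx => ?_
                rw [prod_abs_lapMatrix_mul G (hJ2 hμ) (hswap hx)]
                exact mul_le_mul_of_nonneg_right (two_le_prod_abs_lapMatrix_swap hρ h2 hadj hx)
                  (he0 μ)
      _ = ∑ τ ∈ (J ×ˢ ρ.support).image (fun p : Perm V × V => p.1 * swap p.2 (ρ p.2)),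
            ∏ i, |G.lapMatrix ℝ (τ i) i| := by
          rw [sum_image hinj, sum_product]
      _ ≤ _ := by
          refine sum_le_sum_of_subset_of_nonneg (fun τ hτ => ?_) fun τ _ _ => hb0 τ
          obtain ⟨⟨μ, x⟩, hp, rfl⟩ := mem_image.mp hτ
          obtain ⟨hμ, hx⟩ := mem_product.mp hp
          simp only at hμ hx ⊢
          rw [mem_erase]
          constructor
          · rintro rfl
            have h1 := happ hμ hx x hx
            rw [hJ2 hσJ x hx, swap_apply_left] at h1
            exact Perm.mem_support.mp hx h1.symm
          · rw [hI, mem_filter]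
            refine ⟨mem_univ _, ?_⟩
            have hd : Perm.Disjoint μ (swap x (ρ x)) := fun i => by
              by_cases hi : i ∈ ρ.support
              · exact .inl (hJ2 hμ i hi)
              · exact .inr (hswap hx i hi)
            rw [hd.commute.mul_pow, hJ1 hμ, one_mul, pow_two, swap_mul_self]
  · rw [mul_sum]
    calc ∑ μ ∈ J, 6 * ∏ i ∈ ρ.supportᶜ, |G.lapMatrix ℝ (μ i) i|
        ≤ ∑ μ ∈ J, ∏ i, |G.lapMatrix ℝ (μ i) i| := by
          refine sum_le_sum fun μ hμ => ?_
          have h1 := prod_abs_lapMatrix_mul G (π := 1) (hJ2 hμ) fun _ _ => rfl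
          rw [mul_one] at h1
          rw [h1]
          exact mul_le_mul_of_nonneg_right
            (by linarith [eight_le_prod_abs_lapMatrix_one hρ h2 hadj]) (he0 μ)
      _ ≤ _ := by
          refine sum_le_sum_of_subset_of_nonneg (fun μ hμ => ?_) fun τ _ _ => hb0 τ
          rw [mem_erase, hI, mem_filter]
          exact ⟨fun h => hσJ (h ▸ hμ), mem_univ _, hJ1 hμ⟩

include hρ h2 hadj in
/-- The total weight of the permutations of order at least three is at most twice the weight of the
involutions of the complement of the cycle. -/
theorem sum_abs_prod_le_two_mul_sum
    (hG : ∀ C C' : G.Subgraph, C.IsCycleSubgraph → C'.IsCycleSubgraph → C = C') :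
    ∑ τ : Perm V with τ ^ 2 ≠ 1, |∏ i, G.lapMatrix ℝ (τ i) i| ≤
      2 * ∑ μ : Perm V with μ ^ 2 = 1 ∧ ∀ i ∈ ρ.support, μ i = i,
        ∏ i ∈ ρ.supportᶜ, |G.lapMatrix ℝ (μ i) i| := by
  set J : Finset (Perm V) := {μ : Perm V | μ ^ 2 = 1 ∧ ∀ i ∈ ρ.support, μ i = i} with hJ
  have hJ2 {μ : Perm V} (h : μ ∈ J) : ∀ i ∈ ρ.support, μ i = i := (mem_filter.mp h).2.2
  have hsum {π : Perm V} (hπ : π.support = ρ.support) (hπadj : ∀ i, π i ≠ i → G.Adj i (π i)) :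
      ∑ τ ∈ J.image (· * π), |∏ i, G.lapMatrix ℝ (τ i) i| =
        ∑ μ ∈ J, ∏ i ∈ ρ.supportᶜ, |G.lapMatrix ℝ (μ i) i| := by
    rw [sum_image fun _ _ _ _ h => mul_right_cancel h]
    refine sum_congr rfl fun μ hμ => ?_
    rw [abs_prod, prod_abs_lapMatrix_mul G (hJ2 hμ)
      (fun i hi => Perm.notMem_support.mp (hπ ▸ hi)), ← hπ, prod_abs_lapMatrix_cycle hπadj, one_mul]
  have hinv : ∀ i, ρ⁻¹ i ≠ i → G.Adj i (ρ⁻¹ i) := fun i hi => by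
    have := hadj (ρ⁻¹ i) (by rw [← mul_apply, mul_inv_cancel]; exact hi.symm)
    rw [← mul_apply, mul_inv_cancel, one_apply] at this
    exact this.symm
  calc _ ≤ ∑ τ ∈ J.image (· * ρ) ∪ J.image (· * ρ⁻¹), |∏ i, G.lapMatrix ℝ (τ i) i| := by
        -- Only nonzero products force moves along edges.
        rw [← sum_filter_ne_zero]
        refine sum_le_sum_of_subset_of_nonneg (fun τ hτ => ?_) fun _ _ _ => abs_nonneg _
        rw [mem_filter, mem_filter, abs_ne_zero] at hτ
        obtain ⟨μ, h1, h3, h4⟩ := exists_disjoint_involution_of_sq_ne_one hG hρ h2 hadj hτ.1.2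
          (adj_of_prod_lapMatrix_ne_zero G hτ.2)
        have hμ : μ ∈ J := mem_filter.mpr ⟨mem_univ _, h1, h3⟩
        rw [mem_union, mem_image, mem_image]
        exact h4.imp (fun h => ⟨μ, hμ, h.symm⟩) fun h => ⟨μ, hμ, h.symm⟩
    _ ≤ ∑ τ ∈ J.image (· * ρ), |∏ i, G.lapMatrix ℝ (τ i) i| +
          ∑ τ ∈ J.image (· * ρ⁻¹), |∏ i, G.lapMatrix ℝ (τ i) i| := by
        rw [← sum_union_inter]
        exact le_add_of_nonneg_right (sum_nonneg fun _ _ => abs_nonneg _)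
    _ = _ := by rw [hsum rfl hadj, hsum (support_inv ρ) hinv, two_mul]

end Cycle

/-! ### Assembling the inequality -/

theorem permanent_hadamard_lapMatrix_le
    (hG : ∀ C C' : G.Subgraph, C.IsCycleSubgraph → C'.IsCycleSubgraph → C = C') :
    (G.lapMatrix ℝ ⊙ G.lapMatrix ℝ).permanent ≤ (G.lapMatrix ℝ).permanent ^ 2 := by
  simp only [Matrix.permanent, Matrix.hadamard_apply, ← pow_two, prod_pow]
  have habs {σ : Perm V} (hσ : σ ∈ ({σ | σ ^ 2 = 1} : Finset (Perm V))) :=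
    prod_lapMatrix_eq_abs_of_sq_eq_one G (mem_filter.mp hσ).2
  refine sum_sq_le_sq_sum_of_dominant (fun σ : Perm V => ∏ i, G.lapMatrix ℝ (σ i) i)
    {σ | σ ^ 2 = 1} ⟨1, by simp⟩ (fun σ hσ => ?_) fun σ hσ => ?_
  · rw [habs hσ]
    exact prod_nonneg fun _ _ => abs_nonneg _
  · rw [habs hσ, sum_congr rfl fun τ hτ => habs hτ, compl_filter]
    -- A contributing non-involution supplies the rotation `ρ`, and `6E = 3 * 2E`; without one, the
    -- non-involutions weigh nothing.
    by_cases h : ∃ τ : Perm V, τ ^ 2 ≠ 1 ∧ ∏ i, G.lapMatrix ℝ (τ i) i ≠ 0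
    · obtain ⟨τ, h1, h2⟩ := h
      obtain ⟨x, hx⟩ : ∃ x, (τ ^ 2) x ≠ x := by
        by_contra! h; exact h1 (Perm.ext h)
      obtain ⟨hc, hc2, hcadj⟩ := cycleOf_isCycle_and_adj (adj_of_prod_lapMatrix_ne_zero G h2) hx
      have h3 := sum_abs_prod_le_two_mul_sum hc hc2 hcadj hG
      have h4 := add_six_mul_sum_le_sum_involutions hc hc2 hcadj (mem_filter.mp hσ).2
      linarith
    · push Not at h
      rw [sum_eq_zero fun τ hτ => by rw [h τ (mem_filter.mp hτ).2, abs_zero], mul_zero, add_zero]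
      exact single_le_sum (f := fun τ : Perm V => ∏ i, |G.lapMatrix ℝ (τ i) i|)
        (fun _ _ => prod_nonneg fun _ _ => abs_nonneg _) hσ

end SimpleGraph

theorem corollary5p4 {V : Type*} [Fintype V] [DecidableEq V] (G : SimpleGraph V)
    [DecidableRel G.Adj] (hG : G.IsUnicyclic) :
    (G.lapMatrix ℝ ⊙ G.lapMatrix ℝ).permanent ≤ (G.lapMatrix ℝ).permanent ^ 2 :=
  SimpleGraph.permanent_hadamard_lapMatrix_le fun _ _ hC hC' => hG.2.unique hC hC'
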